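/- For $k\in\mathbb Z$ let $\mathcal M^k$ (resp. $\widetilde{\mathcal M}^k$) be the $\mathbb Q$-vector space of modular (resp. quasimodular) forms of weight $k$ for $SL(2,\mathbb Z)$ whose $q$-expansions, $q=e^{2\pi i\tau}$, have rational coefficients. Here a quasimodular form of weight $k$ is a function $f$ on the upper half plane $\mathfrak h$ for which there are finitely many functions $Q_0,\dots,Q_p$, holomorphic on $\mathfrak h$ and bounded at $i\infty$, with $(c\tau+d)^{-k}f\left(\frac{a\tau+b}{c\tau+d}\right)=\sum_{i=0}^p Q_i(\tau)\left(\frac{c}{c\tau+d}\right)^i$ for all $\begin{pmatrix}a&b\\c&d\end{pmatrix}\in SL(2,\mathbb Z)$ and $\tau\in\mathfrak h$. A Jacobi-like form of weight $k$ and index $\lambda$ is a formal power series $F(z,\tau)=\sum_{j\ge0}\chi_j(\tau)z^j$ with coefficients $\chi_j$ holomorphic on $\mathfrak h$ such that $$F\left(\frac{z}{c\tau+d},\frac{a\tau+b}{c\tau+d}\right)=(c\tau+d)^k\exp\left(\frac{c\lambda}{c\tau+d}\frac{z^2}{2\pi i}\right)F(z,\tau)\qquad\text{for all }\begin{pmatrix}a&b\\c&d\end{pmatrix}\in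 SL(2,\mathbb Z).$$ Let $\mathcal J^+_{\mathbb Q,k,\lambda}$ be the set of those $F$ with $\chi_j\in\widetilde{\mathcal M}^{k+j}$ for all $j$ and $\chi_j=0$ for all odd $j$. **Lemma.** Let $k\in\mathbb Z$, let $\phi\in\mathcal M^k$ and put $s_{2j}=\dim_{\mathbb Q}\mathcal M^{k+2j}$. Then there is a unique element $$\phi^\natural(z,q)=\sum_{j=0}^\infty\chi_{2j}(q)z^{2j}\in\mathcal J^+_{\mathbb Q,k,1}$$ such that $\chi_0=\phi$ and, for every $j>0$, $$\chi_{2j}(q)\in q^{s_{2j}}\mathbb Q[[q]]\cap\widetilde{\mathcal M}^{k+2j}.$$ -/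

import Mathlib

open UpperHalfPlane ModularForm
open scoped MatrixGroups Manifold

namespace JacobiLike

noncomputable section

/-- The ring `Hol(ℍ)` of holomorphic functions on the upper half plane. -/
def Hol : Subalgebra ℂ (ℍ → ℂ) where
  carrier := {f | MDifferentiable 𝓘(ℂ) 𝓘(ℂ) f}
  mul_mem' hf hg := MDifferentiable.mul hf hg
  add_mem' hf hg := MDifferentiable.add hf hg
  algebraMap_mem' _ := mdifferentiable_const

/-- Evaluation of holomorphic functions at a point of the upper half plane. -/
def evalAt (τ : ℍ) : Hol →+* ℂ := (Pi.evalRingHom (fun _ : ℍ => ℂ) τ).comp Hol.val.toRingHom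

/-- The power series `F(z, τ) ∈ ℂ⟦z⟧` obtained from `F ∈ Hol(ℍ)⟦z⟧` by fixing `τ`. -/
def specialize (F : PowerSeries Hol) (τ : ℍ) : PowerSeries ℂ := PowerSeries.map (evalAt τ) F

/-- The coefficient `χ_j` of `z^j` in `F ∈ Hol(ℍ)⟦z⟧`, as a function on the upper half plane. -/
def chi (F : PowerSeries Hol) (j : ℕ) : ℍ → ℂ := (PowerSeries.coeff j F).val

/-- `F ∈ Hol(ℍ)⟦z⟧` is a Jacobi-like form of weight `k` and index `lam`: for all
`γ = (a, b; c, d) ∈ SL(2, ℤ)` and all `τ`, in `ℂ⟦z⟧`,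
`F(z / (cτ + d), γτ) = (cτ + d)^k exp((c lam / (cτ + d)) z² / (2πi)) F(z, τ)`. -/
def IsJacobiLike (k : ℤ) (lam : ℂ) (F : PowerSeries Hol) : Prop :=
  ∀ (γ : SL(2, ℤ)) (τ : ℍ),
    PowerSeries.rescale (denom γ τ)⁻¹ (specialize F (γ • τ)) =
      PowerSeries.C (denom γ τ ^ k) *
        PowerSeries.expand 2 two_ne_zero
          (PowerSeries.rescale
            (((γ 1 0 : ℤ) : ℂ) * lam / denom γ τ / (2 * Real.pi * Complex.I))
            (PowerSeries.exp ℂ)) *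
        specialize F τ

/-- The `q`-expansion of `f` (with `q = exp(2πiτ)`) has rational coefficients. -/
def HasRationalQExpansion (f : ℍ → ℂ) : Prop :=
  ∃ g : PowerSeries ℚ, qExpansion 1 f = PowerSeries.map (algebraMap ℚ ℂ) g

/-- The `q`-expansion of `f` lies in `q^s ℚ⟦q⟧`. -/
def QExpansionMemQPow (s : ℕ) (f : ℍ → ℂ) : Prop :=
  ∃ g : PowerSeries ℚ, qExpansion 1 f = PowerSeries.map (algebraMap ℚ ℂ) (PowerSeries.X ^ s * g)

/-- The `ℚ`-vector space of modular forms of weight `k` and level one with rational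
`q`-expansion, as a space of functions on the upper half plane. -/
def ratModularForms (k : ℤ) : Submodule ℚ (ℍ → ℂ) where
  carrier := {f | (∃ g : ModularForm 𝒮ℒ k, (g : ℍ → ℂ) = f) ∧ HasRationalQExpansion f}
  zero_mem' := ⟨⟨0, rfl⟩, 0, by simpa using qExpansion_zero 1⟩
  add_mem' := by
    rintro _ _ ⟨⟨f, rfl⟩, a, ha⟩ ⟨⟨g, rfl⟩, b, hb⟩
    refine ⟨⟨f + g, rfl⟩, a + b, ?_⟩
    rw [map_add, ← ha, ← hb]
    exact ModularForm.qExpansion_add one_pos one_mem_strictPeriods_SL f g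
  smul_mem' := by
    rintro c _ ⟨⟨f, rfl⟩, a, ha⟩
    have h2 : c • (f : ℍ → ℂ) = (c : ℂ) • (f : ℍ → ℂ) := by
      ext τ
      simp [Rat.smul_def]
    refine ⟨⟨(c : ℂ) • f, h2.symm⟩, c • a, ?_⟩
    have h := ModularForm.qExpansion_smul one_pos one_mem_strictPeriods_SL (c : ℂ) f
    rw [h2, h, ha]
    ext n
    simp

/-- `f` is a quasimodular form of weight `k` and level one: there are finitely many functions
`Q 0, …, Q p`, holomorphic on `ℍ` and bounded at `i∞`, with
`(cτ + d)^(-k) f(γτ) = ∑ i ≤ p, Q i (τ) (c / (cτ + d))^i` for all `γ ∈ SL(2, ℤ)`.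
(For `γ = 1` this says `f = Q 0`, so `f` itself is holomorphic on `ℍ` and at `i∞`.) -/
def IsQuasimodular (k : ℤ) (f : ℍ → ℂ) : Prop :=
  ∃ (p : ℕ) (Q : ℕ → ℍ → ℂ),
    (∀ i, MDifferentiable 𝓘(ℂ) 𝓘(ℂ) (Q i) ∧ IsBoundedAtImInfty (Q i)) ∧
    ∀ (γ : SL(2, ℤ)) (τ : ℍ),
      (f ∣[k] γ) τ =
        ∑ i ∈ Finset.range (p + 1), Q i τ * (((γ 1 0 : ℤ) : ℂ) / denom γ τ) ^ i

/-- Quasimodular forms of weight `k` and level one with rational `q`-expansion. -/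
def ratQuasimodularForms (k : ℤ) : Set (ℍ → ℂ) :=
  {f | IsQuasimodular k f ∧ HasRationalQExpansion f}

/-- Even Jacobi-like forms of weight `k` and index `lam` whose coefficient of `z^j` is a
quasimodular form of weight `k + j` with rational `q`-expansion, for every `j`. -/
def ratEvenJacobiLikeForms (k : ℤ) (lam : ℂ) : Set (PowerSeries Hol) :=
  {F | IsJacobiLike k lam F ∧
    (∀ j : ℕ, chi F j ∈ ratQuasimodularForms (k + j)) ∧
    ∀ j : ℕ, Odd j → chi F j = 0}

end

end JacobiLike

namespace JacobiLike

/-! Existence. Under `γ` the form `E₂ / 12` picks up, besides its weight 2 factor, exactly the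
summand `c / (2πi (cτ + d))`. Hence `exp(E₂ z² / 12)` produces the exponential factor of a
Jacobi-like form of index 1, and `exp(E₂ z² / 12) ∑ f_j z^(2j)` is such a form for every choice of
modular `f_j` of weight `k + 2j`. Its coefficient of `z^(2j)` is `f_j` plus an expression in the
`f_i` with `i < j` (`chi_jacobiSeries`), so the `f_j` can be chosen recursively, starting from `φ`,
as soon as a modular form can cancel the first `dim M^(k+2j)` coefficients of any rational series
(`exists_X_pow_dvd_add`).

By equality of dimensions this reduces to `isDetermined`: a form vanishing to order `dim M^k` is
zero. The proof is an induction in steps of 12, using `M^k = ℚ e ⊕ Δ M^(k-12)` with `e` of constant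
term 1: dimension and order of vanishing both drop by one.

Uniqueness. In the first coefficient where two solutions differ, the difference is modular
(`IsJacobiLike.slash_chi_sub`) and vanishes to order `dim M^(k+2j)`, so it is zero. -/

open Function Filter

/-! ### Regular functions and rational `q`-expansions -/

/-- A function on the upper half plane which is holomorphic, `1`-periodic and bounded at `i∞`,
so that it is represented by its `q`-expansion. -/
structure IsRegular (f : ℍ → ℂ) : Prop where
  mdifferentiable : MDifferentiable 𝓘(ℂ) 𝓘(ℂ) f
  periodic : Periodic (f ∘ ofComplex) 1
  bounded : IsBoundedAtImInfty f

namespace IsRegular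

variable {f g : ℍ → ℂ}

lemma analyticAt (hf : IsRegular f) : AnalyticAt ℂ (cuspFunction 1 f) 0 :=
  analyticAt_cuspFunction_zero one_pos (mod_cast hf.periodic) hf.mdifferentiable hf.bounded

lemma add (hf : IsRegular f) (hg : IsRegular g) : IsRegular (f + g) :=
  ⟨hf.mdifferentiable.add hg.mdifferentiable, hf.periodic.add hg.periodic,
    hf.bounded.add hg.bounded⟩

lemma mul (hf : IsRegular f) (hg : IsRegular g) : IsRegular (f * g) :=
  ⟨hf.mdifferentiable.mul hg.mdifferentiable, hf.periodic.mul hg.periodic,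
    hf.bounded.mul hg.bounded⟩

lemma const (c : ℂ) : IsRegular (Function.const ℍ c) :=
  ⟨mdifferentiable_const, fun _ ↦ rfl, const_boundedAtFilter _ c⟩

lemma qExpansion_eq_zero_iff (hf : IsRegular f) : qExpansion 1 f = 0 ↔ f = 0 :=
  UpperHalfPlane.qExpansion_eq_zero_iff one_pos (mod_cast hf.periodic) hf.mdifferentiable hf.bounded

lemma qExpansion_coeff_unique (hf : IsRegular f) {c : ℕ → ℂ}
    (h : ∀ τ : ℍ, HasSum (fun m ↦ c m • Periodic.qParam 1 τ ^ m) (f τ)) (m : ℕ) :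
    c m = PowerSeries.coeff m (qExpansion 1 f) :=
  letI : FunLike (ℍ → ℂ) ℍ ℂ := ⟨id, injective_id⟩
  UpperHalfPlane.qExpansion_coeff_unique (F := ℍ → ℂ) f one_pos hf.analyticAt h m

end IsRegular

lemma qExpansion_const (c : ℂ) : qExpansion 1 (Function.const ℍ c) = PowerSeries.C c := by
  have h := qExpansion_smul (h := 1) (f := 1) (IsRegular.const 1).analyticAt c
  rw [qExpansion_one] at h
  rw [show Function.const ℍ c = c • (1 : ℍ → ℂ) by ext; simp, h]
  ext n
  simp [PowerSeries.coeff_one, PowerSeries.coeff_C]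

/-- A function invariant under the translation `T` in some weight is `1`-periodic. -/
lemma periodic_of_slash_T {k : ℤ} {f : ℍ → ℂ} (h : f ∣[k] ModularGroup.T = f) :
    Periodic (f ∘ ofComplex) 1 := by
  have hT (τ : ℍ) : f ((1 : ℝ) +ᵥ τ) = f τ := by
    conv_rhs => rw [← h, SL_slash_apply, modular_T_smul]
    rw [ModularGroup.denom_apply]
    simp [ModularGroup.T]
  intro w
  by_cases! hw : 0 < w.im
  · have h1 : 0 < (w + 1).im := by simp [hw]
    simp only [comp_apply, ofComplex_apply_of_im_pos h1, ofComplex_apply_of_im_pos hw]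
    refine Eq.trans (congrArg f ?_) (hT ⟨w, hw⟩)
    ext
    simp [add_comm]
  · have h1 : (w + 1).im ≤ 0 := by simpa using hw
    simp [ofComplex_apply_of_im_nonpos h1, ofComplex_apply_of_im_nonpos hw]

lemma isRegular_modularForm {k : ℤ} (f : ModularForm 𝒮ℒ k) : IsRegular f :=
  ⟨f.holo', mod_cast SlashInvariantFormClass.periodic_comp_ofComplex f one_mem_strictPeriods_SL, by
    have : Fact (IsCusp OnePoint.infty 𝒮ℒ) :=
      ⟨Subgroup.isCusp_of_mem_strictPeriods one_pos one_mem_strictPeriods_SL⟩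
    exact ModularFormClass.bdd_at_infty f⟩

/-- A holomorphic function bounded at `i∞` and invariant under `SL(2, ℤ)` in weight `k` is a
modular form. -/
lemma exists_modularForm_of_slash_eq {k : ℤ} {f : ℍ → ℂ} (hf : MDifferentiable 𝓘(ℂ) 𝓘(ℂ) f)
    (hb : IsBoundedAtImInfty f) (hs : ∀ γ : SL(2, ℤ), f ∣[k] γ = f) :
    ∃ g : ModularForm 𝒮ℒ k, (g : ℍ → ℂ) = f :=
  ⟨{ toFun := f
     slash_action_eq' := fun _ ⟨γ, hγ⟩ ↦ hγ ▸ hs γ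
     holo' := hf
     -- Every cusp is an `SL(2, ℤ)`-translate of `i∞`, and slashing by the translating element does
     -- not change `f`.
     bdd_at_cusps' {c} hc := by
       rw [Subgroup.IsArithmetic.isCusp_iff_isCusp_SL2Z] at hc
       rw [OnePoint.isBoundedAt_iff_forall_SL2Z hc]
       intro γ _
       rw [hs γ]
       exact hb }, rfl⟩

/-- Regular functions with rational `q`-expansion form a `ℚ`-algebra. -/
def ratRegular : Subalgebra ℚ (ℍ → ℂ) where
  carrier := {f | IsRegular f ∧ HasRationalQExpansion f}
  mul_mem' := by
    rintro f g ⟨hf, a, ha⟩ ⟨hg, b, hb⟩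
    exact ⟨hf.mul hg, a * b, by rw [qExpansion_mul hf.analyticAt hg.analyticAt, ha, hb, map_mul]⟩
  add_mem' := by
    rintro f g ⟨hf, a, ha⟩ ⟨hg, b, hb⟩
    exact ⟨hf.add hg, a + b, by rw [qExpansion_add hf.analyticAt hg.analyticAt, ha, hb, map_add]⟩
  algebraMap_mem' c := by
    have h : algebraMap ℚ (ℍ → ℂ) c = Function.const ℍ (c : ℂ) := by
      ext
      simp
    exact h ▸ ⟨IsRegular.const _, PowerSeries.C c, by simp [qExpansion_const]⟩

lemma ratModularForms_le_ratRegular (k : ℤ) :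
    ratModularForms k ≤ Subalgebra.toSubmodule ratRegular := by
  rintro _ ⟨⟨f, rfl⟩, h⟩
  exact ⟨isRegular_modularForm f, h⟩

lemma mul_mem_ratModularForms {k l : ℤ} {f g : ℍ → ℂ} (hf : f ∈ ratModularForms k)
    (hg : g ∈ ratModularForms l) : f * g ∈ ratModularForms (k + l) := by
  refine ⟨?_, (ratRegular.mul_mem (ratModularForms_le_ratRegular k hf)
    (ratModularForms_le_ratRegular l hg)).2⟩
  obtain ⟨⟨f, rfl⟩, -⟩ := hf
  obtain ⟨⟨g, rfl⟩, -⟩ := hg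
  exact ⟨f.mul g, rfl⟩

/-- The rational `q`-expansion of an element of `ratRegular`. -/
noncomputable def ratQExpansion : ratRegular →ₗ[ℚ] PowerSeries ℚ where
  toFun f := f.2.2.choose
  map_add' f g := by
    apply PowerSeries.map_injective _ (algebraMap ℚ ℂ).injective
    rw [map_add, ← f.2.2.choose_spec, ← g.2.2.choose_spec, ← (f + g).2.2.choose_spec]
    exact qExpansion_add f.2.1.analyticAt g.2.1.analyticAt
  map_smul' c f := by
    apply PowerSeries.map_injective _ (algebraMap ℚ ℂ).injective
    refine (c • f).2.2.choose_spec.symm.trans ?_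
    have h : ((c • f : ratRegular) : ℍ → ℂ) = (c : ℂ) • (f : ℍ → ℂ) := by
      ext
      simp [Rat.smul_def]
    rw [h, qExpansion_smul f.2.1.analyticAt]
    refine (congrArg ((c : ℂ) • ·) f.2.2.choose_spec).trans ?_
    ext n
    simp

lemma qExpansion_eq_map_ratQExpansion (f : ratRegular) :
    qExpansion 1 (f : ℍ → ℂ) = PowerSeries.map (algebraMap ℚ ℂ) (ratQExpansion f) :=
  f.2.2.choose_spec

lemma ratQExpansion_injective : Injective ratQExpansion := by
  rw [← LinearMap.ker_eq_bot, LinearMap.ker_eq_bot']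
  intro f hf
  have h := qExpansion_eq_map_ratQExpansion f
  rw [hf, map_zero, f.2.1.qExpansion_eq_zero_iff] at h
  exact Subtype.ext h

lemma qExpansionMemQPow_iff (f : ratRegular) (s : ℕ) :
    QExpansionMemQPow s f ↔ PowerSeries.X ^ s ∣ ratQExpansion f := by
  rw [QExpansionMemQPow, qExpansion_eq_map_ratQExpansion]
  exact exists_congr fun g ↦ (PowerSeries.map_injective _ (algebraMap ℚ ℂ).injective).eq_iff

lemma ratQExpansion_mul (f g : ratRegular) :
    ratQExpansion (f * g) = ratQExpansion f * ratQExpansion g := by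
  apply PowerSeries.map_injective _ (algebraMap ℚ ℂ).injective
  rw [(PowerSeries.map _).map_mul, ← qExpansion_eq_map_ratQExpansion,
    ← qExpansion_eq_map_ratQExpansion, ← qExpansion_eq_map_ratQExpansion]
  exact qExpansion_mul f.2.1.analyticAt g.2.1.analyticAt

/-! ### Rationality of the Eisenstein series and the discriminant -/

open EisensteinSeries in
lemma E2_mem_ratRegular : E2 ∈ ratRegular := by
  -- The correction term of `E2` is proportional to the lower left entry, which is 0 for `T`.
  have hT : E2 ∣[(2 : ℤ)] ModularGroup.T = E2 := by
    rw [E2_slash_action, D2_T, smul_zero, sub_zero]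
  have hreg : IsRegular E2 :=
    ⟨E2_mdifferentiable, periodic_of_slash_T hT, isBoundedAtImInfty_E2⟩
  refine ⟨hreg, PowerSeries.mk fun m ↦ if m = 0 then 1 else -24 * ArithmeticFunction.sigma 1 m, ?_⟩
  ext m
  have hq (τ : ℍ) : HasSum (fun m : ℕ ↦ (if m = 0 then 1 else
      -24 * ArithmeticFunction.sigma 1 m : ℂ) • Periodic.qParam 1 τ ^ m) (E2 τ) := by
    simpa only [Periodic.qParam, Complex.ofReal_one, div_one] using hasSum_qExpansion_E2 τ
  rw [← hreg.qExpansion_coeff_unique hq m]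
  simp only [PowerSeries.coeff_map, PowerSeries.coeff_mk]
  split_ifs <;> simp

open EisensteinSeries in
lemma E_mem_ratModularForms {k : ℕ} (hk : 3 ≤ k) (hk2 : Even k) :
    (E hk : ℍ → ℂ) ∈ ratModularForms k := by
  refine ⟨⟨E hk, rfl⟩, PowerSeries.mk fun m ↦ if m = 0 then 1 else
    -(2 * k / bernoulli k) * (ArithmeticFunction.sigma (k - 1) m), ?_⟩
  ext m
  rw [E_qExpansion_coeff hk hk2]
  split_ifs with h <;> simp [h]

lemma discriminant_mem_ratModularForms : ModularForm.discriminant ∈ ratModularForms 12 := by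
  have h4 : (E₄ : ℍ → ℂ) ∈ ratRegular :=
    ratModularForms_le_ratRegular _ (E_mem_ratModularForms (by norm_num) ⟨2, rfl⟩)
  have h6 : (E₆ : ℍ → ℂ) ∈ ratRegular :=
    ratModularForms_le_ratRegular _ (E_mem_ratModularForms (by norm_num) ⟨3, rfl⟩)
  refine ⟨⟨(CuspForm.discriminant : ModularForm 𝒮ℒ 12), rfl⟩, ?_⟩
  have h : ModularForm.discriminant = (1 / 1728 : ℚ) • ((E₄ : ℍ → ℂ) ^ 3 - (E₆ : ℍ → ℂ) ^ 2) := by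
    ext z
    rw [discriminant_eq_E₄_cube_sub_E₆_sq]
    simp [Rat.smul_def]
    ring
  rw [h]
  exact (ratRegular.smul_mem (sub_mem (pow_mem h4 3) (pow_mem h6 2)) _).2

/-! ### Modular forms are determined by their first `dim M^k` coefficients -/

/-- The rational `q`-expansion of a modular form in `ratModularForms k`. -/
noncomputable def modularQExpansion (k : ℤ) : ratModularForms k →ₗ[ℚ] PowerSeries ℚ :=
  ratQExpansion.comp (Submodule.inclusion (ratModularForms_le_ratRegular k))

lemma qExpansion_eq_map_modularQExpansion {k : ℤ} (f : ratModularForms k) :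
    qExpansion 1 (f : ℍ → ℂ) = PowerSeries.map (algebraMap ℚ ℂ) (modularQExpansion k f) :=
  qExpansion_eq_map_ratQExpansion ⟨f, ratModularForms_le_ratRegular k f.2⟩

/-- Multiplication by the discriminant, as a map between spaces of rational modular forms. -/
noncomputable def discriminantMul (k : ℤ) : ratModularForms (k - 12) →ₗ[ℚ] ratModularForms k where
  toFun g := ⟨ModularForm.discriminant * g, by
    simpa using mul_mem_ratModularForms discriminant_mem_ratModularForms g.2⟩
  map_add' g h := Subtype.ext (mul_add _ _ _)
  map_smul' c g := Subtype.ext (mul_smul_comm _ _ _)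

lemma discriminantMul_injective (k : ℤ) : Injective (discriminantMul k) := by
  intro f g h
  ext τ
  exact mul_left_cancel₀ (discriminant_ne_zero τ) (congrFun (congrArg Subtype.val h) τ)

/-- The rational `q`-expansion of the discriminant. -/
noncomputable def discriminantSeries : PowerSeries ℚ :=
  modularQExpansion 12 ⟨_, discriminant_mem_ratModularForms⟩

lemma modularQExpansion_discriminantMul {k : ℤ} (g : ratModularForms (k - 12)) :
    modularQExpansion k (discriminantMul k g) =
      discriminantSeries * modularQExpansion (k - 12) g :=
  ratQExpansion_mul
    ⟨_, ratModularForms_le_ratRegular _ discriminant_mem_ratModularForms⟩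
    ⟨_, ratModularForms_le_ratRegular _ g.2⟩

lemma exists_discriminantSeries_eq :
    ∃ u : PowerSeries ℚ, PowerSeries.constantCoeff u ≠ 0 ∧
      discriminantSeries = PowerSeries.X * u := by
  have h : qExpansion 1 ModularForm.discriminant =
      PowerSeries.map (algebraMap ℚ ℂ) discriminantSeries :=
    qExpansion_eq_map_modularQExpansion ⟨_, discriminant_mem_ratModularForms⟩
  have h0 : PowerSeries.constantCoeff discriminantSeries = 0 := by
    have := PowerSeries.coeff_of_lt_order 0
      (discriminant_qExpansion_order.symm ▸ zero_lt_one : (0 : ℕ∞) < _)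
    simpa [h] using this
  obtain ⟨u, hu⟩ := PowerSeries.X_dvd_iff.mpr h0
  refine ⟨u, fun hu0 ↦ ?_, hu⟩
  have h1 := discriminant_qExpansion_coeff_one
  rw [h, hu, PowerSeries.coeff_map, ← zero_add 1, PowerSeries.coeff_succ_X_mul] at h1
  simp [hu0] at h1

/-- A cusp form is divisible by the discriminant over `ℂ`; the quotient is again rational because
the discriminant is `q` times a unit of `ℚ⟦q⟧`. -/
lemma mem_range_discriminantMul {k : ℤ} {f : ratModularForms k}
    (hf : PowerSeries.constantCoeff (modularQExpansion k f) = 0) :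
    f ∈ LinearMap.range (discriminantMul k) := by
  have hq := qExpansion_eq_map_modularQExpansion f
  obtain ⟨p, hp⟩ := PowerSeries.X_dvd_iff.mpr hf
  obtain ⟨u, hu0, hu⟩ := exists_discriminantSeries_eq
  obtain ⟨⟨F, hF⟩, -⟩ := f.2
  have hF0 : (qExpansion 1 F).coeff 0 = 0 := by
    rw [hF, hq]
    simp [hf]
  have hΔ : qExpansion 1 ModularForm.discriminant = _ :=
    qExpansion_eq_map_modularQExpansion ⟨_, discriminant_mem_ratModularForms⟩
  have hmul := qExpansion_eq_qExpansion_discriminant_mul F hF0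
  have hdiv := discriminant_mul_discriminantEquiv (toCuspForm F hF0)
  set G := CuspForm.discriminantEquiv (toCuspForm F hF0)
  -- With `f = q p` and `Δ = q u`, the quotient has expansion `u⁻¹ p`.
  refine ⟨⟨G, ⟨G, rfl⟩, u⁻¹ * p, ?_⟩, Subtype.ext (hdiv.trans hF)⟩
  have hu' : u⁻¹ * u = 1 := PowerSeries.inv_mul_cancel u hu0
  rw [hF, hq, hp, hΔ] at hmul
  change _ = PowerSeries.map (algebraMap ℚ ℂ) discriminantSeries * _ at hmul
  rw [hu, map_mul, map_mul, mul_assoc, PowerSeries.map_X] at hmul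
  rw [map_mul, mul_left_cancel₀ PowerSeries.X_ne_zero hmul, ← mul_assoc, ← map_mul, hu', map_one,
    one_mul]

/-- The space of rational modular forms of weight `k` is finite dimensional, of dimension `d` say,
and a form is determined by the first `d` coefficients of its `q`-expansion. -/
def IsDetermined (k : ℤ) : Prop :=
  Module.Finite ℚ (ratModularForms k) ∧
    ∀ f : ratModularForms k,
      PowerSeries.X ^ Module.finrank ℚ (ratModularForms k) ∣ modularQExpansion k f → f = 0

lemma IsDetermined.of_subsingleton {k : ℤ} (h : Subsingleton (ModularForm 𝒮ℒ k)) :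
    IsDetermined k := by
  have : Subsingleton (ratModularForms k) := by
    refine ⟨?_⟩
    rintro ⟨_, ⟨f, rfl⟩, _⟩ ⟨_, ⟨g, rfl⟩, _⟩
    exact Subtype.ext (congrArg DFunLike.coe (Subsingleton.elim f g))
  exact ⟨inferInstance, fun f _ ↦ Subsingleton.elim _ _⟩

/-- The form `e` splits off the constant term, and what remains is `Δ M^(k-12)`. So the dimension
grows by one, while cancelling `Δ = q u` lowers the order of vanishing by one. -/
lemma IsDetermined.of_sub_twelve {k : ℤ} (h : IsDetermined (k - 12)) {e : ratModularForms k}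
    (he : PowerSeries.constantCoeff (modularQExpansion k e) = 1) : IsDetermined k := by
  obtain ⟨hfin, h⟩ := h
  obtain ⟨u, hu0, hu⟩ := exists_discriminantSeries_eq
  let ψ : ℚ × ratModularForms (k - 12) →ₗ[ℚ] ratModularForms k :=
    (LinearMap.toSpanSingleton ℚ _ e).coprod (discriminantMul k)
  have hψ (x) : ψ x = x.1 • e + discriminantMul k x.2 := by simp [ψ]
  have hinj : Injective ψ := by
    rw [← LinearMap.ker_eq_bot, LinearMap.ker_eq_bot']
    rintro ⟨a, g⟩ hag
    rw [hψ] at hag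
    -- Multiples of the discriminant have no constant term, so the constant term of the sum is `a`.
    have ha : a = 0 := by
      have := congrArg (PowerSeries.constantCoeff ∘ modularQExpansion k) hag
      simpa [modularQExpansion_discriminantMul, he, hu] using this
    subst ha
    rw [zero_smul, zero_add] at hag
    exact Prod.ext rfl (discriminantMul_injective k (hag.trans (map_zero _).symm))
  have hsurj : Surjective ψ := by
    intro f
    have hmem : f - PowerSeries.constantCoeff (modularQExpansion k f) • e ∈
        LinearMap.range (discriminantMul k) :=
      mem_range_discriminantMul (by simp [he])
    obtain ⟨g, hg⟩ := hmem
    exact ⟨(PowerSeries.constantCoeff (modularQExpansion k f), g), by rw [hψ, hg]; simp⟩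
  let Ψ := LinearEquiv.ofBijective ψ ⟨hinj, hsurj⟩
  have hrank : Module.finrank ℚ (ratModularForms k) =
      Module.finrank ℚ (ratModularForms (k - 12)) + 1 := by
    rw [← Ψ.finrank_eq, Module.finrank_prod, Module.finrank_self, add_comm]
  refine ⟨Module.Finite.equiv Ψ, fun f hf ↦ ?_⟩
  rw [hrank] at hf
  obtain ⟨g, rfl⟩ := mem_range_discriminantMul
    (PowerSeries.X_dvd_iff.mp ((dvd_pow_self _ (Nat.succ_ne_zero _)).trans hf))
  rw [modularQExpansion_discriminantMul, hu, pow_succ', mul_assoc,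
    mul_dvd_mul_iff_left PowerSeries.X_ne_zero] at hf
  have hunit : IsUnit u := PowerSeries.isUnit_iff_constantCoeff.mpr hu0.isUnit
  rw [h g (hunit.dvd_mul_left.mp hf), map_zero]

/-- In negative weight, odd weight and weight 2 there are no nonzero forms. In the remaining weights
the form of constant term 1 is the constant 1 for `k = 0` and the Eisenstein series for even `k ≥
4`. -/
lemma isDetermined (k : ℤ) : IsDetermined k := by
  rcases lt_or_ge k 0 with hk | hk
  · exact .of_subsingleton (rank_zero_iff.mp (levelOne_neg_weight_rank_zero hk))
  rcases Int.even_or_odd k with hev | hodd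
  swap
  · exact .of_subsingleton (rank_zero_iff.mp (levelOne_odd_weight_rank_zero hodd))
  have ih := isDetermined (k - 12)
  lift k to ℕ using hk
  rcases lt_or_ge k 3 with hk3 | hk3
  · obtain rfl | rfl : k = 0 ∨ k = 2 := by
      have : Even k := mod_cast hev
      interval_cases k <;> simp_all
    · have hone : (1 : ℍ → ℂ) ∈ ratModularForms 0 := ⟨⟨1, rfl⟩, 1, by simp [qExpansion_one]⟩
      refine ih.of_sub_twelve (e := ⟨1, hone⟩) ((algebraMap ℚ ℂ).injective ?_)
      have := qExpansion_eq_map_modularQExpansion ⟨1, hone⟩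
      rw [qExpansion_one] at this
      simpa using (congrArg (PowerSeries.coeff 0) this).symm
    · exact .of_subsingleton (rank_zero_iff.mp levelOne_weight_two_rank_zero)
  · have hE := E_mem_ratModularForms hk3 (mod_cast hev)
    refine ih.of_sub_twelve (e := ⟨_, hE⟩) ((algebraMap ℚ ℂ).injective ?_)
    have h1 := EisensteinSeries.E_qExpansion_coeff_zero hk3 (mod_cast hev)
    rw [qExpansion_eq_map_modularQExpansion ⟨_, hE⟩] at h1
    simpa using h1
-- The shift by 1 makes the measure drop from `k = 0` to `k = -12` as well.
termination_by (k + 1).toNat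
decreasing_by lia

/-- Any rational power series can be corrected by a modular form of weight `k` so as to vanish to
order `dim M^k`. -/
lemma exists_X_pow_dvd_add (k : ℤ) (p : PowerSeries ℚ) : ∃ f : ratModularForms k,
    PowerSeries.X ^ Module.finrank ℚ (ratModularForms k) ∣ p + modularQExpansion k f := by
  obtain ⟨hfin, h⟩ := isDetermined k
  let T : PowerSeries ℚ →ₗ[ℚ] (Fin (Module.finrank ℚ (ratModularForms k)) → ℚ) :=
    LinearMap.pi fun i ↦ PowerSeries.coeff (i : ℕ)
  have hinj : Injective (T ∘ₗ modularQExpansion k) := by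
    rw [← LinearMap.ker_eq_bot, LinearMap.ker_eq_bot']
    intro f hf
    exact h f (PowerSeries.X_pow_dvd_iff.mpr fun m hm ↦ congrFun hf ⟨m, hm⟩)
  -- The truncation is an injective map between spaces of the same finite dimension.
  have hsurj : Surjective (T ∘ₗ modularQExpansion k) :=
    (LinearMap.injective_iff_surjective_of_finrank_eq_finrank (by simp)).mp hinj
  obtain ⟨f, hf⟩ := hsurj (T (-p))
  refine ⟨f, PowerSeries.X_pow_dvd_iff.mpr fun m hm ↦ ?_⟩
  have := congrFun hf ⟨m, hm⟩
  simp only [T, LinearMap.comp_apply, LinearMap.pi_apply, map_neg] at this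
  rw [map_add, this, add_neg_cancel]

/-! ### Uniqueness -/

namespace IsQuasimodular

variable {k : ℤ} {f : ℍ → ℂ}

/-- For matrices with `c = 0` only the term `Q 0` survives: the identity gives `f = Q 0`, and `T`
then gives periodicity. -/
lemma isRegular (hf : IsQuasimodular k f) : IsRegular f := by
  obtain ⟨p, Q, hQ, h⟩ := hf
  have h0 (γ : SL(2, ℤ)) (hγ : γ 1 0 = 0) : f ∣[k] γ = Q 0 := by
    ext τ
    rw [h γ τ, Finset.sum_range_succ', Finset.sum_eq_zero (by simp [hγ])]
    simp
  have h1 : f = Q 0 := by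
    rw [← h0 1 (by simp), SlashAction.slash_one]
  refine ⟨h1 ▸ (hQ 0).1, periodic_of_slash_T (k := k) ?_, h1 ▸ (hQ 0).2⟩
  rw [h0 _ (by simp [ModularGroup.T]), h1]

lemma zero : IsQuasimodular k 0 :=
  ⟨0, 0, fun _ ↦ ⟨mdifferentiable_const, const_boundedAtFilter _ 0⟩, fun γ τ ↦ by
    simp [SL_slash_apply]⟩

end IsQuasimodular

lemma mem_ratRegular_of_mem_ratQuasimodularForms {k : ℤ} {f : ℍ → ℂ}
    (hf : f ∈ ratQuasimodularForms k) : f ∈ ratRegular :=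
  ⟨hf.1.isRegular, hf.2⟩

lemma coeff_specialize (F : PowerSeries Hol) (τ : ℍ) (j : ℕ) :
    PowerSeries.coeff j (specialize F τ) = chi F j τ := by
  rw [specialize, PowerSeries.coeff_map]
  rfl

/-- The first coefficient in which two Jacobi-like forms of the same weight and index differ is
modular. -/
lemma IsJacobiLike.slash_chi_sub {k : ℤ} {lam : ℂ} {F G : PowerSeries Hol}
    (hF : IsJacobiLike k lam F) (hG : IsJacobiLike k lam G) {j : ℕ}
    (h : ∀ i < j, chi F i = chi G i) (γ : SL(2, ℤ)) :
    (chi F j - chi G j) ∣[k + j] γ = chi F j - chi G j := by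
  ext τ
  have hd : denom γ τ ≠ 0 := denom_ne_zero γ τ
  have key := congrArg (PowerSeries.coeff j) (congrArg₂ (· - ·) (hF γ τ) (hG γ τ))
  simp only [← mul_sub, map_sub, PowerSeries.coeff_rescale, coeff_specialize] at key
  -- The coefficients of `F - G` below `j` vanish, so only the constant term 1 of the exponential
  -- factor meets the `j`-th coefficient.
  rw [PowerSeries.coeff_mul, Finset.sum_eq_single (0, j)] at key
  · simp only [PowerSeries.coeff_zero_eq_constantCoeff, map_mul, PowerSeries.constantCoeff_C,
      PowerSeries.constantCoeff_expand, map_sub, coeff_specialize] at key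
    rw [← PowerSeries.coeff_zero_eq_constantCoeff_apply (PowerSeries.rescale _ _),
      PowerSeries.coeff_rescale] at key
    simp only [pow_zero, PowerSeries.coeff_zero_eq_constantCoeff,
      PowerSeries.constantCoeff_exp, mul_one] at key
    rw [SL_slash_apply, zpow_neg, zpow_add₀ hd, zpow_natCast, Pi.sub_apply, Pi.sub_apply,
      mul_inv, mul_left_comm, ← mul_comm (_⁻¹ : ℂ), ← inv_pow, key,
      inv_mul_cancel_left₀ (zpow_ne_zero _ hd)]
  · rintro ⟨a, b⟩ hab hne
    rw [Finset.HasAntidiagonal.mem_antidiagonal] at hab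
    have hb : b < j := by
      rcases Nat.eq_zero_or_pos a with rfl | ha
      · exact absurd (congrArg (Prod.mk 0) ((zero_add b).symm.trans hab)) hne
      · lia
    rw [map_sub, coeff_specialize, coeff_specialize, h b hb, sub_self, mul_zero]
  · simp

/-- Two even rational Jacobi-like forms with the same constant term, all of whose higher
coefficients vanish to order `dim M^{k+2j}`, are equal. -/
lemma eq_of_chi_zero_eq {k : ℤ} {lam : ℂ} {F G : PowerSeries Hol}
    (hF : F ∈ ratEvenJacobiLikeForms k lam) (hG : G ∈ ratEvenJacobiLikeForms k lam)
    (h0 : chi F 0 = chi G 0)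
    (hFq : ∀ j : ℕ, 0 < j → QExpansionMemQPow
      (Module.finrank ℚ (ratModularForms (k + 2 * j))) (chi F (2 * j)))
    (hGq : ∀ j : ℕ, 0 < j → QExpansionMemQPow
      (Module.finrank ℚ (ratModularForms (k + 2 * j))) (chi G (2 * j))) : F = G := by
  suffices h : ∀ j, chi F j = chi G j from PowerSeries.ext fun j ↦ Subtype.ext (h j)
  intro j
  induction j using Nat.strong_induction_on with | _ j ih
  rcases Nat.even_or_odd j with hj | hj
  swap
  · rw [hF.2.2 j hj, hG.2.2 j hj]
  obtain ⟨m, rfl⟩ := even_iff_exists_two_mul.mp hj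
  rcases Nat.eq_zero_or_pos m with rfl | hm
  · exact h0
  have hs := hF.1.slash_chi_sub hG.1 ih
  have hrF := mem_ratRegular_of_mem_ratQuasimodularForms (hF.2.1 (2 * m))
  have hrG := mem_ratRegular_of_mem_ratQuasimodularForms (hG.2.1 (2 * m))
  have hr := sub_mem hrF hrG
  push_cast at hs
  have hmem : chi F (2 * m) - chi G (2 * m) ∈ ratModularForms (k + 2 * m) :=
    ⟨exists_modularForm_of_slash_eq hr.1.mdifferentiable hr.1.bounded hs, hr.2⟩
  have hdvd := dvd_sub ((qExpansionMemQPow_iff ⟨_, hrF⟩ _).mp (hFq m hm))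
    ((qExpansionMemQPow_iff ⟨_, hrG⟩ _).mp (hGq m hm))
  rw [← map_sub] at hdvd
  exact sub_eq_zero.mp (congrArg Subtype.val ((isDetermined _).2 ⟨_, hmem⟩ hdvd))

/-! ### Construction of Jacobi-like forms from `E₂` -/

lemma rescale_expand {R : Type*} [CommRing R] (p : ℕ) (hp : p ≠ 0) (a : R) (f : PowerSeries R) :
    PowerSeries.rescale a (PowerSeries.expand p hp f) =
      PowerSeries.expand p hp (PowerSeries.rescale (a ^ p) f) := by
  ext n
  rw [PowerSeries.coeff_rescale, PowerSeries.coeff_expand, PowerSeries.coeff_expand]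
  split_ifs with h
  · obtain ⟨m, rfl⟩ := h
    rw [Nat.mul_div_cancel_left _ (Nat.pos_of_ne_zero hp), PowerSeries.coeff_rescale, pow_mul]
  · rw [mul_zero]

/-- The function `E₂ / 12` as an element of `Hol`. -/
noncomputable def e2Hol : Hol :=
  (1 / 12 : ℂ) • ⟨EisensteinSeries.E2, E2_mdifferentiable⟩

lemma e2Hol_mem_ratRegular : (e2Hol : ℍ → ℂ) ∈ ratRegular := by
  have h : (e2Hol : ℍ → ℂ) = (1 / 12 : ℚ) • EisensteinSeries.E2 := by
    ext
    simp [e2Hol, Rat.smul_def]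
  exact h ▸ ratRegular.smul_mem E2_mem_ratRegular _

/-- The factor `1 / 12` is chosen so that, with `ζ(2) = π² / 6`, the anomaly of `E₂` becomes the
coefficient in the exponential factor of index 1. -/
lemma e2Hol_smul (γ : SL(2, ℤ)) (τ : ℍ) :
    (e2Hol : ℍ → ℂ) (γ • τ) = denom γ τ ^ 2 *
      (((γ 1 0 : ℤ) : ℂ) * 1 / denom γ τ / (2 * Real.pi * Complex.I) + (e2Hol : ℍ → ℂ) τ) := by
  have hd : denom γ τ ≠ 0 := denom_ne_zero γ τ
  have h := congrFun (EisensteinSeries.E2_slash_action γ) τ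
  rw [SL_slash_apply, zpow_neg, ← div_eq_mul_inv, div_eq_iff (zpow_ne_zero _ hd)] at h
  have hpi : (Real.pi : ℂ) ≠ 0 := mod_cast Real.pi_ne_zero
  have he (z : ℍ) : (e2Hol : ℍ → ℂ) z = 1 / 12 * EisensteinSeries.E2 z := rfl
  rw [he, he, h, Pi.sub_apply, Pi.smul_apply, EisensteinSeries.D2, riemannZeta_two, smul_eq_mul]
  have hI : Complex.I⁻¹ = -Complex.I := Complex.inv_I
  rw [div_eq_mul_inv _ (2 * (Real.pi : ℂ) * Complex.I), mul_inv _ Complex.I, hI]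
  rw [zpow_ofNat]
  field_simp
  ring

section Construction

variable {k : ℤ} (f : ∀ j : ℕ, ratModularForms (k + 2 * j))

/-- A modular form as an element of `Hol`. -/
def modularHol {k : ℤ} (f : ratModularForms k) : Hol :=
  ⟨f, (ratModularForms_le_ratRegular k f.2).1.mdifferentiable⟩

/-- The series `exp(E₂ w / 12) ∑ f_j w^j`; substituting `w = z²` gives a Jacobi-like form of
index one. -/
noncomputable def jacobiSeries : PowerSeries Hol :=
  PowerSeries.mk (fun j ↦ modularHol (f j)) * PowerSeries.rescale e2Hol (PowerSeries.exp Hol)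

lemma modularForm_smul {k : ℤ} (f : ratModularForms k) (γ : SL(2, ℤ)) (τ : ℍ) :
    (f : ℍ → ℂ) (γ • τ) = denom γ τ ^ k * (f : ℍ → ℂ) τ := by
  obtain ⟨_, ⟨g, rfl⟩, -⟩ := f
  have h := congrFun (SlashInvariantForm.slash_action_eqn g γ ⟨γ, rfl⟩) τ
  rw [← SL_slash, SL_slash_apply, zpow_neg, ← div_eq_mul_inv,
    div_eq_iff (zpow_ne_zero _ (denom_ne_zero γ τ))] at h
  rw [mul_comm]
  exact h

/-- The transformation law of `jacobiSeries`. -/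
lemma rescale_specialize_jacobiSeries (γ : SL(2, ℤ)) (τ : ℍ) :
    PowerSeries.rescale ((denom γ τ)⁻¹ ^ 2) (specialize (jacobiSeries f) (γ • τ)) =
      PowerSeries.C (denom γ τ ^ k) *
        PowerSeries.rescale
            (((γ 1 0 : ℤ) : ℂ) * 1 / denom γ τ / (2 * Real.pi * Complex.I))
            (PowerSeries.exp ℂ) *
        specialize (jacobiSeries f) τ := by
  have hd : denom γ τ ≠ 0 := denom_ne_zero γ τ
  have hsp (z : ℍ) : specialize (jacobiSeries f) z =
      PowerSeries.mk (fun j ↦ (f j : ℍ → ℂ) z) *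
        PowerSeries.rescale ((e2Hol : ℍ → ℂ) z) (PowerSeries.exp ℂ) := by
    rw [specialize, jacobiSeries, map_mul, ← PowerSeries.rescale_map, PowerSeries.map_exp]
    rfl
  rw [hsp, hsp, map_mul, ← RingHom.comp_apply (PowerSeries.rescale _) (PowerSeries.rescale _),
    ← PowerSeries.rescale_mul, e2Hol_smul, mul_right_comm, inv_pow,
    mul_inv_cancel₀ (pow_ne_zero 2 hd), one_mul, ← PowerSeries.exp_mul_exp_eq_exp_add]
  have hmk : PowerSeries.rescale (denom γ τ ^ 2)⁻¹
      (PowerSeries.mk (fun j ↦ (f j : ℍ → ℂ) (γ • τ))) =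
      PowerSeries.C (denom γ τ ^ k) * PowerSeries.mk (fun j ↦ (f j : ℍ → ℂ) τ) := by
    ext j
    rw [PowerSeries.coeff_rescale, PowerSeries.coeff_C_mul, PowerSeries.coeff_mk,
      PowerSeries.coeff_mk, modularForm_smul, zpow_add₀ hd, zpow_mul, zpow_natCast, zpow_ofNat,
      inv_pow, mul_comm (denom γ τ ^ k), mul_assoc,
      inv_mul_cancel_left₀ (pow_ne_zero _ (pow_ne_zero _ hd))]
  rw [hmk]
  ring

lemma isJacobiLike_expand_jacobiSeries :
    IsJacobiLike k 1 (PowerSeries.expand 2 two_ne_zero (jacobiSeries f)) := by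
  intro γ τ
  have hsp (z : ℍ) : specialize (PowerSeries.expand 2 two_ne_zero (jacobiSeries f)) z =
      PowerSeries.expand 2 two_ne_zero (specialize (jacobiSeries f) z) :=
    PowerSeries.map_expand ..
  rw [hsp, hsp, rescale_expand, rescale_specialize_jacobiSeries, map_mul, map_mul,
    PowerSeries.expand_C]

/-- The part of the `j`-th coefficient of `jacobiSeries f` which only involves `f i` for `i < j`. -/
noncomputable def lowerPart (j : ℕ) (g : ∀ i : Fin j, ratModularForms (k + 2 * (i : ℕ))) :
    ratRegular :=
  ⟨∑ i : Fin j, (1 / (j - i : ℕ).factorial : ℚ) •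
    ((g i : ℍ → ℂ) * (e2Hol : ℍ → ℂ) ^ (j - i : ℕ)),
    sum_mem fun i _ ↦ ratRegular.smul_mem (mul_mem
      (ratModularForms_le_ratRegular _ (g i).2) (pow_mem e2Hol_mem_ratRegular _)) _⟩

lemma chi_jacobiSeries (j : ℕ) :
    chi (jacobiSeries f) j = lowerPart j (fun i ↦ f i) + (f j : ℍ → ℂ) := by
  have h : PowerSeries.coeff j (jacobiSeries f) =
      ∑ i : Fin j, (1 / (j - i : ℕ).factorial : ℚ) •
        (modularHol (f i) * e2Hol ^ (j - i : ℕ)) + modularHol (f j) := by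
    rw [jacobiSeries, PowerSeries.coeff_mul, Finset.Nat.sum_antidiagonal_eq_sum_range_succ_mk,
      Finset.sum_range_succ, Finset.sum_range]
    congr 1
    · refine Finset.sum_congr rfl fun i _ ↦ ?_
      rw [PowerSeries.coeff_mk, PowerSeries.coeff_rescale, PowerSeries.coeff_exp, Algebra.smul_def]
      ring
    · simp
  rw [chi, h, lowerPart]
  simp
  rfl

lemma chi_jacobiSeries_mem_ratRegular (j : ℕ) : chi (jacobiSeries f) j ∈ ratRegular := by
  rw [chi_jacobiSeries]
  exact add_mem (lowerPart j _).2 (ratModularForms_le_ratRegular _ (f j).2)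

lemma qExpansionMemQPow_chi_jacobiSeries_iff (j s : ℕ) :
    QExpansionMemQPow s (chi (jacobiSeries f) j) ↔
      PowerSeries.X ^ s ∣
        ratQExpansion (lowerPart j fun i ↦ f i) + modularQExpansion _ (f j) := by
  let x : ratRegular := ⟨f j, ratModularForms_le_ratRegular _ (f j).2⟩
  have h : chi (jacobiSeries f) j = (lowerPart j (fun i ↦ f i) + x : ratRegular) :=
    chi_jacobiSeries f j
  rw [h, qExpansionMemQPow_iff, map_add]
  rfl

/-- Comparing coefficients of `w^m` in the transformation law, the exponential series supplies the
powers of `c / (cτ + d)`, and `Q i` is `χ_(m-i)` times `(2πi)⁻ⁱ / i!` (here `χ_n` is the coefficient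
of `w^n`). For `i > m` the truncated difference `m - i` is harmless, since such `i` do not enter the
sum. -/
lemma chi_jacobiSeries_mem_ratQuasimodularForms (m : ℕ) :
    chi (jacobiSeries f) m ∈ ratQuasimodularForms (k + 2 * m) := by
  refine ⟨⟨m, fun i ↦ Function.const ℍ ((2 * Real.pi * Complex.I)⁻¹ ^ i / i.factorial) *
    chi (jacobiSeries f) (m - i), fun i ↦ ?_, fun γ τ ↦ ?_⟩,
    (chi_jacobiSeries_mem_ratRegular f m).2⟩
  · have h := (IsRegular.const ((2 * Real.pi * Complex.I)⁻¹ ^ i / i.factorial)).mul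
      (chi_jacobiSeries_mem_ratRegular f (m - i)).1
    exact ⟨h.mdifferentiable, h.bounded⟩
  · have hd : denom γ τ ≠ 0 := denom_ne_zero γ τ
    have key := congrArg (PowerSeries.coeff m) (rescale_specialize_jacobiSeries f γ τ)
    rw [PowerSeries.coeff_rescale, coeff_specialize, mul_assoc, PowerSeries.coeff_C_mul,
      PowerSeries.coeff_mul, Finset.Nat.sum_antidiagonal_eq_sum_range_succ_mk] at key
    rw [SL_slash_apply, zpow_neg, zpow_add₀ hd, zpow_mul, zpow_natCast, zpow_ofNat, mul_inv,
      mul_left_comm, mul_comm (chi _ _ _), ← inv_pow, ← inv_pow, key,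
      inv_mul_cancel_left₀ (zpow_ne_zero _ hd)]
    refine Finset.sum_congr rfl fun i _ ↦ ?_
    rw [PowerSeries.coeff_rescale, coeff_specialize, PowerSeries.coeff_exp]
    simp only [Pi.mul_apply, Function.const_apply, map_div₀, map_one, map_natCast, mul_one]
    rw [div_eq_mul_inv (_ / _) (2 * _ * _), mul_pow]
    ring

lemma chi_expand_two_mul (H : PowerSeries Hol) (m : ℕ) :
    chi (PowerSeries.expand 2 two_ne_zero H) (2 * m) = chi H m := by
  rw [chi, PowerSeries.coeff_expand_mul, chi]

lemma chi_expand_of_odd (H : PowerSeries Hol) {j : ℕ} (hj : Odd j) :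
    chi (PowerSeries.expand 2 two_ne_zero H) j = 0 := by
  rw [chi, PowerSeries.coeff_expand_of_not_dvd _ _ _
    (by rwa [← even_iff_two_dvd, Nat.not_even_iff_odd])]
  rfl

lemma expand_jacobiSeries_mem_ratEvenJacobiLikeForms :
    PowerSeries.expand 2 two_ne_zero (jacobiSeries f) ∈ ratEvenJacobiLikeForms k 1 := by
  refine ⟨isJacobiLike_expand_jacobiSeries f, fun j ↦ ?_, fun j ↦ chi_expand_of_odd _⟩
  rcases Nat.even_or_odd j with hj | hj
  · obtain ⟨m, rfl⟩ := even_iff_exists_two_mul.mp hj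
    rw [chi_expand_two_mul]
    exact mod_cast chi_jacobiSeries_mem_ratQuasimodularForms f m
  · rw [chi_expand_of_odd _ hj]
    exact ⟨.zero, ratRegular.zero_mem.2⟩

end Construction

/-! ### Recursive choice of the modular forms -/

/-- Dependent choice of a sequence along strong induction. -/
lemma exists_seq_of_forall_exists {X : ℕ → Type*} {P : ∀ j, (∀ i : Fin j, X i) → X j → Prop}
    (h : ∀ j g, ∃ x, P j g x) : ∃ f : ∀ j, X j, ∀ j, P j (fun i ↦ f i) (f j) := by
  choose s hs using h
  let f : ∀ j, X j := Nat.lt_wfRel.wf.fix fun j g ↦ s j fun i ↦ g i i.2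
  refine ⟨f, fun j ↦ ?_⟩
  have hf : f j = s j fun i ↦ f i := Nat.lt_wfRel.wf.fix_eq _ j
  rw [hf]
  exact hs j _

lemma exists_modularForms_seq {k : ℤ} {φ : ℍ → ℂ} (hφ : φ ∈ ratModularForms k) :
    ∃ f : ∀ j : ℕ, ratModularForms (k + 2 * j), (f 0 : ℍ → ℂ) = φ ∧
      ∀ j : ℕ, 0 < j → QExpansionMemQPow (Module.finrank ℚ (ratModularForms (k + 2 * j)))
        (chi (jacobiSeries f) j) := by
  obtain ⟨f, hf⟩ := exists_seq_of_forall_exists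
    (X := fun j : ℕ ↦ ratModularForms (k + 2 * j))
    -- The vanishing condition on `x` depends on the earlier forms only, through `lowerPart j g`, so
    -- it can be solved one index at a time.
    (P := fun j g x ↦ (j = 0 → (x : ℍ → ℂ) = φ) ∧
      (0 < j → PowerSeries.X ^ Module.finrank ℚ (ratModularForms (k + 2 * j)) ∣
        ratQExpansion (lowerPart j g) + modularQExpansion _ x)) (by
    intro j g
    rcases Nat.eq_zero_or_pos j with rfl | hj
    · exact ⟨⟨φ, by simpa using hφ⟩, fun _ ↦ rfl, fun h ↦ absurd h (lt_irrefl 0)⟩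
    · obtain ⟨x, hx⟩ := exists_X_pow_dvd_add (k + 2 * j) (ratQExpansion (lowerPart j g))
      exact ⟨x, fun h ↦ absurd h hj.ne', fun _ ↦ hx⟩)
  exact ⟨f, (hf 0).1 rfl, fun j hj ↦
    (qExpansionMemQPow_chi_jacobiSeries_iff f j _).mpr ((hf j).2 hj)⟩

end JacobiLike

theorem mainTheorem6 (k : ℤ) (φ : ℍ → ℂ) (hφ : φ ∈ JacobiLike.ratModularForms k) :
    ∃! F : PowerSeries JacobiLike.Hol,
      F ∈ JacobiLike.ratEvenJacobiLikeForms k 1 ∧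
      JacobiLike.chi F 0 = φ ∧
      ∀ j : ℕ, 0 < j →
        JacobiLike.QExpansionMemQPow
            (Module.finrank ℚ (JacobiLike.ratModularForms (k + 2 * j)))
            (JacobiLike.chi F (2 * j)) ∧
          JacobiLike.chi F (2 * j) ∈ JacobiLike.ratQuasimodularForms (k + 2 * j) := by
  obtain ⟨f, hf0, hf⟩ := JacobiLike.exists_modularForms_seq hφ
  refine ⟨PowerSeries.expand 2 two_ne_zero (JacobiLike.jacobiSeries f),
    ⟨JacobiLike.expand_jacobiSeries_mem_ratEvenJacobiLikeForms f, ?_, fun j hj ↦ ?_⟩, ?_⟩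
  · rw [← mul_zero 2, JacobiLike.chi_expand_two_mul, JacobiLike.chi_jacobiSeries]
    -- For `j = 0` the lower part is an empty sum, leaving `f 0 = φ`.
    simpa [JacobiLike.lowerPart] using hf0
  · rw [JacobiLike.chi_expand_two_mul]
    exact ⟨hf j hj, JacobiLike.chi_jacobiSeries_mem_ratQuasimodularForms f j⟩
  · rintro G ⟨hG, hG0, hGq⟩
    refine JacobiLike.eq_of_chi_zero_eq hG
      (JacobiLike.expand_jacobiSeries_mem_ratEvenJacobiLikeForms f) ?_ (fun j hj ↦ (hGq j hj).1)
      fun j hj ↦ ?_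
    · rw [hG0, ← mul_zero 2, JacobiLike.chi_expand_two_mul, JacobiLike.chi_jacobiSeries]
      simpa [JacobiLike.lowerPart] using hf0.symm
    · rw [JacobiLike.chi_expand_two_mul]
      exact hf j hj
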